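/- For integers $0\le\tau\le n$ and $M\ge 1$, a binary orthogonal array (BOA) with parameters $(n,M,\tau)$ is an $M\times n$ matrix $C$ with entries in $\{0,1\}$ (repeated rows are allowed) such that in every $M\times\tau$ submatrix of $C$ each of the $2^\tau$ ordered $\tau$-tuples over $\{0,1\}$ occurs as a row exactly $\lambda=M/2^\tau$ times. There exist no binary orthogonal arrays with parameters $(10,\,7\cdot 2^6=448,\,6)$, $(11,\,7\cdot 2^7=896,\,7)$, $(12,\,10\cdot 2^8=2560,\,8)$, $(13,\,10\cdot 2^9=5120,\,9)$, $(12,\,11\cdot 2^8=2816,\,8)$, $(13,\,11\cdot 2^9=5632,\,9)$ or $(15,\,13\cdot 2^{10}=13312,\,10)$. -/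

import Mathlib

/-- `C`, an `M × n` matrix over `{0, 1}` (rows may be repeated), is a binary orthogonal array of
strength `τ` and index `lam = M / 2 ^ τ`: in every `M × τ` submatrix of `C` each ordered
`τ`-tuple of `{0, 1}` occurs exactly `lam` times as a row. -/
def IsBinaryOrthogonalArray {M n : ℕ} (C : Matrix (Fin M) (Fin n) (Fin 2)) (τ lam : ℕ) : Prop :=
  τ ≤ n ∧ M = lam * 2 ^ τ ∧
    ∀ (cols : Fin τ ↪o Fin n) (t : Fin τ → Fin 2),
      (Finset.univ.filter fun r : Fin M => ∀ i, C r (cols i) = t i).card = lam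

/-- There is a binary orthogonal array with parameters (length, cardinality, strength)
`(n, M, τ)`. -/
def ExistsBOA (n M τ : ℕ) : Prop :=
  ∃ (C : Matrix (Fin M) (Fin n) (Fin 2)) (lam : ℕ), IsBinaryOrthogonalArray C τ lam

/-! Let m(x) be the multiplicity of x as a row and N = 2^n. Strength τ means that N m - M has no
Fourier coefficient on sets of size at most τ. If 2n ≤ 3τ + 2, two sets of size above τ have
symmetric difference of size at most τ, so N m - M is orthogonal to its own square: its third moment
vanishes. Rearranged, this is `sum_rowMult_cubic`: N Σ m(m-1)(N m - 3M + N) = M(N-M)(2M-N). For M <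
N every summand is nonnegative, since m is an integer. Hence 2M ≥ N, which excludes indices 7 and
13. For indices 10 and 11 the same identity bounds the sum of squared character sums from above,
while integrality of row counts forces large character sums on sets of size τ + 1 or τ + 2. The
parameters of lengths 11 and 13 reduce to those of lengths 10 and 12 by shortening. -/

/-- The character `x ↦ (-1) ^ (∑ i ∈ S, x i)` of the binary cube. -/
def cubeChar {n : ℕ} (S : Finset (Fin n)) (x : Fin n → Fin 2) : ℤ :=
  ∏ i ∈ S, (-1) ^ (x i : ℕ)

/-- The sum of a character of the cube over the rows of an array. -/
def charSum {R : Type*} [Fintype R] {n : ℕ} (C : R → Fin n → Fin 2) (S : Finset (Fin n)) : ℤ :=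
  ∑ r, cubeChar S (C r)

/-- The number of rows of an array equal to a given point of the cube. -/
def rowMult {R : Type*} [Fintype R] {n : ℕ} (C : R → Fin n → Fin 2) (x : Fin n → Fin 2) : ℤ :=
  ((Finset.univ.filter fun r => C r = x).card : ℤ)

/-- All nontrivial character sums of order at most `τ` vanish. -/
def CharSumsVanish {R : Type*} [Fintype R] {n : ℕ} (C : R → Fin n → Fin 2) (τ : ℕ) : Prop :=
  ∀ S : Finset (Fin n), S.Nonempty → S.card ≤ τ → charSum C S = 0

/-! ### Characters of the cube and their orthogonality -/

section CubeChar

variable {n : ℕ}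

theorem cubeChar_empty (x : Fin n → Fin 2) : cubeChar ∅ x = 1 := by
  simp [cubeChar]

theorem neg_one_pow_mul_self_fin_two (a : Fin 2) : ((-1 : ℤ) ^ (a : ℕ)) * (-1) ^ (a : ℕ) = 1 := by
  fin_cases a <;> simp

theorem cubeChar_mul (S T : Finset (Fin n)) (x : Fin n → Fin 2) :
    cubeChar S x * cubeChar T x = cubeChar (symmDiff S T) x := by
  have hS : cubeChar S x = cubeChar (S \ T) x * cubeChar (S ∩ T) x := by
    unfold cubeChar
    rw [mul_comm, Finset.prod_inter_mul_prod_sdiff]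
  have hT : cubeChar T x = cubeChar (T \ S) x * cubeChar (S ∩ T) x := by
    unfold cubeChar
    rw [mul_comm, Finset.inter_comm, Finset.prod_inter_mul_prod_sdiff]
  have hI : cubeChar (S ∩ T) x * cubeChar (S ∩ T) x = 1 := by
    unfold cubeChar
    rw [← Finset.prod_mul_distrib]
    exact Finset.prod_eq_one fun i _ => neg_one_pow_mul_self_fin_two (x i)
  have hU : cubeChar (symmDiff S T) x = cubeChar (S \ T) x * cubeChar (T \ S) x := by
    unfold cubeChar
    rw [symmDiff_def, Finset.sup_eq_union,
      Finset.prod_union (Finset.disjoint_left.2 fun a h1 h2 => by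
        simp only [Finset.mem_sdiff] at h1 h2; exact h1.2 h2.1)]
  rw [hS, hT, hU]
  linear_combination cubeChar (S \ T) x * cubeChar (T \ S) x * hI

theorem sum_cubeChar_of_nonempty {S : Finset (Fin n)} (hS : S.Nonempty) :
    ∑ x : Fin n → Fin 2, cubeChar S x = 0 := by
  obtain ⟨i, hi⟩ := hS
  have h := (Finset.prod_univ_sum (fun _ : Fin n => (Finset.univ : Finset (Fin 2)))
    (fun j a => if j ∈ S then (-1 : ℤ) ^ (a : ℕ) else 1)).symm
  rw [Fintype.piFinset_univ] at h
  have h2 : ∀ x : Fin n → Fin 2,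
      ∏ j, (if j ∈ S then (-1 : ℤ) ^ (x j : ℕ) else 1) = cubeChar S x := by
    intro x
    rw [Finset.prod_ite_mem, Finset.univ_inter, cubeChar]
  simp only [h2] at h
  rw [h]
  exact Finset.prod_eq_zero (Finset.mem_univ i) (by simp [hi])

theorem sum_cubeChar_mul_cubeChar (x y : Fin n → Fin 2) :
    ∑ S : Finset (Fin n), cubeChar S x * cubeChar S y = if x = y then 2 ^ n else 0 := by
  have h : ∑ S : Finset (Fin n), cubeChar S x * cubeChar S y =
      ∏ i : Fin n, (1 + (-1 : ℤ) ^ (x i : ℕ) * (-1) ^ (y i : ℕ)) := by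
    rw [Finset.prod_one_add, Finset.powerset_univ]
    simp only [cubeChar, Finset.prod_mul_distrib]
  rw [h]
  split_ifs with hxy
  · subst hxy
    simp only [neg_one_pow_mul_self_fin_two]
    simp
  · obtain ⟨i, hi⟩ := Function.ne_iff.1 hxy
    refine Finset.prod_eq_zero (Finset.mem_univ i) ?_
    generalize x i = a at *
    generalize y i = b at *
    revert hi
    fin_cases a <;> fin_cases b <;> simp

end CubeChar

/-! ### Fourier analysis of row multiplicities -/

section CharSum

variable {R : Type*} [Fintype R] {n : ℕ} (C : R → Fin n → Fin 2)

theorem charSum_empty : charSum C ∅ = Fintype.card R := by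
  simp [charSum, cubeChar_empty]

theorem rowMult_eq_sum (x : Fin n → Fin 2) : rowMult C x = ∑ r, if C r = x then 1 else 0 := by
  simp [rowMult]

theorem sum_rowMult_mul (φ : (Fin n → Fin 2) → ℤ) :
    ∑ x, rowMult C x * φ x = ∑ r, φ (C r) := by
  simp only [rowMult_eq_sum, Finset.sum_mul]
  rw [Finset.sum_comm]
  simp

theorem sum_rowMult : ∑ x, rowMult C x = Fintype.card R := by
  simpa using sum_rowMult_mul C (fun _ => 1)

theorem two_pow_mul_rowMult (x : Fin n → Fin 2) :
    2 ^ n * rowMult C x = ∑ S, charSum C S * cubeChar S x := by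
  simp only [charSum, Finset.sum_mul]
  rw [Finset.sum_comm]
  simp only [sum_cubeChar_mul_cubeChar, rowMult_eq_sum, Finset.mul_sum, mul_ite, mul_one, mul_zero]

theorem sum_sq_charSum :
    ∑ S, charSum C S ^ 2 = 2 ^ n * ∑ x, rowMult C x ^ 2 := by
  have h : ∀ x, 2 ^ n * rowMult C x ^ 2 = ∑ S, charSum C S * (rowMult C x * cubeChar S x) := by
    intro x
    have := two_pow_mul_rowMult C x
    calc 2 ^ n * rowMult C x ^ 2 = rowMult C x * (2 ^ n * rowMult C x) := by ring
      _ = _ := by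
        rw [this, Finset.mul_sum]
        exact Finset.sum_congr rfl fun S _ => by ring
  rw [Finset.mul_sum]
  simp only [h]
  rw [Finset.sum_comm]
  refine Finset.sum_congr rfl fun S _ => ?_
  rw [← Finset.mul_sum, sum_rowMult_mul, sq, charSum]

/-- Source of all divisibility: the right side counts rows, hence is an integer multiple of 2^|S|.
-/
theorem sum_powerset_charSum (S : Finset (Fin n)) :
    ∑ T ∈ S.powerset, charSum C T =
      2 ^ S.card * ((Finset.univ.filter fun r => ∀ i ∈ S, C r i = 0).card : ℤ) := by
  simp only [charSum]
  rw [Finset.sum_comm]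
  have h : ∀ r, ∑ T ∈ S.powerset, cubeChar T (C r) =
      if ∀ i ∈ S, C r i = 0 then 2 ^ S.card else 0 := by
    intro r
    simp only [cubeChar]
    rw [← Finset.prod_one_add]
    split_ifs with hr
    · rw [Finset.prod_congr rfl (g := fun _ => (2 : ℤ)) fun i hi => by simp [hr i hi]]
      simp
    · push Not at hr
      obtain ⟨i, hi, h0⟩ := hr
      have h1 : C r i = 1 := by omega
      exact Finset.prod_eq_zero hi (by simp [h1])
  simp only [h]
  rw [← Finset.sum_filter]
  simp [mul_comm]

theorem sum_centered_mul_cubeChar {τ : ℕ} (h : CharSumsVanish C τ) (S : Finset (Fin n))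
    (hS : S.card ≤ τ) :
    ∑ x, (2 ^ n * rowMult C x - Fintype.card R) * cubeChar S x = 0 := by
  have h1 : ∑ x, (2 ^ n * rowMult C x - Fintype.card R) * cubeChar S x =
      2 ^ n * charSum C S - Fintype.card R * ∑ x : Fin n → Fin 2, cubeChar S x := by
    rw [charSum, ← sum_rowMult_mul, Finset.mul_sum, Finset.mul_sum, ← Finset.sum_sub_distrib]
    exact Finset.sum_congr rfl fun x _ => by ring
  rw [h1]
  rcases S.eq_empty_or_nonempty with rfl | hne
  · simp [charSum_empty, cubeChar_empty, mul_comm]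
  · rw [h S hne hS, sum_cubeChar_of_nonempty hne]
    simp

/-- A point in exactly one of the sets lies outside the other, and each complement has at most n - τ
- 1 points. This is the only source of the bound 2n ≤ 3τ + 2. -/
theorem card_symmDiff_le_of_lt_card {τ : ℕ} (hn : 2 * n ≤ 3 * τ + 2) {S T : Finset (Fin n)}
    (hS : τ < S.card) (hT : τ < T.card) : (symmDiff S T).card ≤ τ := by
  have h1 : symmDiff S T ⊆ Sᶜ ∪ Tᶜ := by
    intro i
    simp only [Finset.mem_symmDiff, Finset.mem_union, Finset.mem_compl]
    tauto
  have h2 := (Finset.card_le_card h1).trans (Finset.card_union_le _ _)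
  simp only [Finset.card_compl, Fintype.card_fin] at h2
  have := S.card_le_univ
  have := T.card_le_univ
  simp only [Fintype.card_fin] at *
  omega

/-- The third central moment of the multiplicity function vanishes. -/
theorem sum_centered_pow_three {τ : ℕ} (h : CharSumsVanish C τ) (hn : 2 * n ≤ 3 * τ + 2) :
    ∑ x, (2 ^ n * rowMult C x - Fintype.card R) ^ 3 = 0 := by
  set u : (Fin n → Fin 2) → ℤ := fun x => 2 ^ n * rowMult C x - Fintype.card R with hu
  have hexp : ∀ x, u x = ∑ S ∈ Finset.univ.erase ∅, charSum C S * cubeChar S x := by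
    intro x
    simp only [hu]
    rw [two_pow_mul_rowMult, ← Finset.add_sum_erase _ _ (Finset.mem_univ ∅), charSum_empty,
      cubeChar_empty]
    ring
  have hcube : ∀ x, u x ^ 3 = ∑ S ∈ Finset.univ.erase ∅, ∑ T ∈ Finset.univ.erase ∅,
      charSum C S * charSum C T * (u x * cubeChar (symmDiff S T) x) := by
    intro x
    calc u x ^ 3 = u x * (u x * u x) := by ring
      _ = u x * ((∑ S ∈ Finset.univ.erase ∅, charSum C S * cubeChar S x) *
            ∑ T ∈ Finset.univ.erase ∅, charSum C T * cubeChar T x) := by rw [← hexp]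
      _ = _ := by
        rw [Finset.sum_mul_sum, Finset.mul_sum]
        refine Finset.sum_congr rfl fun S _ => ?_
        rw [Finset.mul_sum]
        refine Finset.sum_congr rfl fun T _ => ?_
        rw [← cubeChar_mul]
        ring
  change ∑ x, u x ^ 3 = 0
  simp only [hcube]
  rw [Finset.sum_comm]
  refine Finset.sum_eq_zero fun S hS => ?_
  rw [Finset.sum_comm]
  refine Finset.sum_eq_zero fun T hT => ?_
  rw [← Finset.mul_sum]
  have hS' := Finset.nonempty_iff_ne_empty.2 (Finset.ne_of_mem_erase hS)
  have hT' := Finset.nonempty_iff_ne_empty.2 (Finset.ne_of_mem_erase hT)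
  by_cases h1 : S.card ≤ τ
  · simp [h S hS' h1]
  by_cases h2 : T.card ≤ τ
  · simp [h T hT' h2]
  rw [sum_centered_mul_cubeChar C h _
    (card_symmDiff_le_of_lt_card hn (not_le.1 h1) (not_le.1 h2)), mul_zero]

/-- The cubic is arranged to vanish at multiplicities 0 and 1; the remaining constant and linear
terms are summed using Σ m = M. -/
theorem sum_rowMult_cubic {τ : ℕ} (h : CharSumsVanish C τ) (hn : 2 * n ≤ 3 * τ + 2)
    {M N : ℤ} (hM : M = Fintype.card R) (hN : N = 2 ^ n) :
    N * ∑ x, rowMult C x * (rowMult C x - 1) * (N * rowMult C x - 3 * M + N) =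
      M * (N - M) * (2 * M - N) := by
  have h3 := sum_centered_pow_three C h hn
  rw [← hM, ← hN] at h3
  have hp : ∀ x, (N * rowMult C x - M) ^ 3 =
      N ^ 2 * (rowMult C x * (rowMult C x - 1) * (N * rowMult C x - 3 * M + N)) +
        ((3 * N * M ^ 2 - 3 * M * N ^ 2 + N ^ 3) * rowMult C x - M ^ 3) := fun x => by ring
  simp only [hp] at h3
  rw [Finset.sum_add_distrib, Finset.sum_sub_distrib, ← Finset.mul_sum, ← Finset.mul_sum,
    sum_rowMult, ← hM] at h3
  have hc : ∑ _x : Fin n → Fin 2, M ^ 3 = N * M ^ 3 := by simp [hN]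
  rw [hc] at h3
  have hN0 : N ≠ 0 := by rw [hN]; positivity
  apply mul_left_cancel₀ hN0
  linear_combination h3

theorem rowMult_eq_natCast (x : Fin n → Fin 2) : ∃ k : ℕ, rowMult C x = k := ⟨_, rfl⟩

/-- An array of strength at least `(2 n - 2) / 3` fills at least half of the cube. -/
theorem two_pow_le_two_mul_card [Nonempty R] {τ : ℕ} (h : CharSumsVanish C τ)
    (hn : 2 * n ≤ 3 * τ + 2) : 2 ^ n ≤ 2 * Fintype.card R := by
  by_contra hlt
  have hcub := sum_rowMult_cubic C h hn rfl rfl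
  have hpos : (0 : ℤ) < Fintype.card R := by exact_mod_cast Fintype.card_pos
  have hlt' : 2 * (Fintype.card R : ℤ) < 2 ^ n := by exact_mod_cast not_le.1 hlt
  have hneg : (Fintype.card R : ℤ) * (2 ^ n - Fintype.card R) * (2 * Fintype.card R - 2 ^ n) < 0 :=
    mul_neg_of_pos_of_neg (mul_pos hpos (by linarith)) (by linarith)
  rw [← hcub] at hneg
  refine absurd hneg (not_lt.2 (mul_nonneg (by positivity) (Finset.sum_nonneg fun x _ => ?_)))
  obtain ⟨k, hk⟩ := rowMult_eq_natCast C x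
  rw [hk]
  rcases k with _ | _ | k
  · simp
  · simp
  -- For m = k + 2 the last factor is N k + 3(N - M), which is positive.
  · push_cast
    refine mul_nonneg (mul_nonneg (by positivity) (by linarith [Int.natCast_nonneg k])) ?_
    nlinarith [mul_nonneg (Int.natCast_nonneg k) (by positivity : (0 : ℤ) ≤ 2 ^ n)]

/-- An upper bound for the variance of the multiplicity function, in terms of character sums. -/
theorem three_mul_sum_sq_charSum_le {τ : ℕ} (h : CharSumsVanish C τ)
    (hn : 2 * n ≤ 3 * τ + 2) (hlt : Fintype.card R < 2 ^ n) :
    3 * ∑ S, charSum C S ^ 2 ≤ 2 * Fintype.card R * (Fintype.card R + 2 ^ n) := by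
  have hcub := sum_rowMult_cubic C h hn rfl rfl
  rw [sum_sq_charSum]
  have hsum := sum_rowMult C
  have hlt' : (Fintype.card R : ℤ) < 2 ^ n := by exact_mod_cast hlt
  have hN : (0 : ℤ) < 2 ^ n := by positivity
  generalize (Fintype.card R : ℤ) = M at *
  generalize (2 ^ n : ℤ) = N at *
  -- The difference of the two sides is N m(m-1)(m-2), nonnegative at every natural number m.
  have hpt : ∀ x, 3 * (N - M) * (rowMult C x ^ 2 - rowMult C x) ≤
      rowMult C x * (rowMult C x - 1) * (N * rowMult C x - 3 * M + N) := by
    intro x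
    obtain ⟨k, hk⟩ := rowMult_eq_natCast C x
    rw [hk]
    rcases k with _ | _ | k
    · simp
    · simp
    · push_cast
      have : (0 : ℤ) ≤ N * k * ((k + 2) * (k + 1)) := by positivity
      linarith
  have hle := Finset.sum_le_sum fun x (_ : x ∈ Finset.univ) => hpt x
  rw [← Finset.mul_sum, Finset.sum_sub_distrib, hsum] at hle
  have h2 := mul_le_mul_of_nonneg_left hle hN.le
  rw [hcub] at h2
  have h3 : (N - M) * (3 * (N * ∑ x, rowMult C x ^ 2)) ≤ (N - M) * (2 * M * (M + N)) := by
    linarith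
  exact le_of_mul_le_mul_left h3 (by linarith)

/-! ### Integrality: lower bounds for character sums -/

theorem sum_powerset_charSum_of_card_eq_succ {τ : ℕ} (h : CharSumsVanish C τ)
    {S : Finset (Fin n)} (hS : S.card = τ + 1) :
    ∑ T ∈ S.powerset, charSum C T = Fintype.card R + charSum C S := by
  have hne : S ≠ ∅ := by rintro rfl; simp at hS
  rw [← charSum_empty C, ← Finset.sum_pair (f := charSum C) hne.symm]
  refine (Finset.sum_subset (by simp [Finset.insert_subset_iff]) fun T hT hT' => ?_).symm
  simp only [Finset.mem_insert, Finset.mem_singleton, not_or] at hT'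
  have := Finset.card_lt_card ((Finset.mem_powerset.1 hT).ssubset_of_ne hT'.2)
  exact h T (Finset.nonempty_iff_ne_empty.2 hT'.1) (by omega)

theorem sum_powerset_charSum_of_card_eq_add_two {τ : ℕ} (h : CharSumsVanish C τ)
    {S : Finset (Fin n)} (hS : S.card = τ + 2) :
    ∑ T ∈ S.powerset, charSum C T =
      Fintype.card R + charSum C S + ∑ T ∈ S.powersetCard (τ + 1), charSum C T := by
  have hne : S ≠ ∅ := by rintro rfl; simp at hS
  have hd : Disjoint ({∅, S} : Finset (Finset (Fin n))) (S.powersetCard (τ + 1)) := by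
    simp [Finset.disjoint_left, Finset.mem_powersetCard, hS]
  rw [← charSum_empty C, ← Finset.sum_pair (f := charSum C) hne.symm, ← Finset.sum_union hd]
  refine (Finset.sum_subset ?_ fun T hT hT' => ?_).symm
  · intro T hT
    simp only [Finset.mem_union, Finset.mem_insert, Finset.mem_singleton,
      Finset.mem_powersetCard] at hT
    rw [Finset.mem_powerset]
    rcases hT with (rfl | rfl) | hT
    · exact Finset.empty_subset _
    · exact subset_rfl
    · exact hT.1
  · simp only [Finset.mem_union, Finset.mem_insert, Finset.mem_singleton,
      Finset.mem_powersetCard, not_or, not_and] at hT'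
    have hsub := Finset.mem_powerset.1 hT
    have := Finset.card_lt_card (hsub.ssubset_of_ne hT'.1.2)
    have := hT'.2 hsub
    exact h T (Finset.nonempty_iff_ne_empty.2 hT'.1.1) (by omega)

/-- For odd index, the character sums of order `τ + 1` are odd multiples of `2 ^ τ`. -/
theorem two_pow_sq_le_sq_charSum {τ lam : ℕ} (h : CharSumsVanish C τ) (hodd : Odd lam)
    (hM : Fintype.card R = lam * 2 ^ τ) {S : Finset (Fin n)} (hS : S.card = τ + 1) :
    (2 ^ τ) ^ 2 ≤ charSum C S ^ 2 := by
  have h1 := sum_powerset_charSum C S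
  rw [sum_powerset_charSum_of_card_eq_succ C h hS, hM, hS] at h1
  push_cast at h1
  set k : ℤ := ((Finset.univ.filter fun r => ∀ i ∈ S, C r i = 0).card : ℤ)
  obtain ⟨l, rfl⟩ := hodd
  have h2 : charSum C S = 2 ^ τ * (2 * (k - l) - 1) := by
    push_cast at h1
    linear_combination h1
  rw [h2, mul_pow]
  refine le_mul_of_one_le_right (by positivity) ?_
  -- An odd integer is nonzero.
  have h3 : (2 * (k - l) - 1) ≠ 0 := by omega
  have := sq_pos_of_ne_zero h3
  omega

/-- For index congruent to `2` modulo `4`, the sum of the squares of the character sums supported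
on a set of `τ + 2` columns is bounded from below. -/
theorem two_pow_succ_sq_le_sum_sq_charSum {τ l : ℕ} (h : CharSumsVanish C τ)
    (hM : Fintype.card R = (2 * (2 * l + 1)) * 2 ^ τ) {S : Finset (Fin n)}
    (hS : S.card = τ + 2) :
    (2 ^ (τ + 1)) ^ 2 ≤ charSum C S ^ 2 + ∑ T ∈ S.powersetCard (τ + 1), charSum C T ^ 2 := by
  have hT : ∀ T ∈ S.powersetCard (τ + 1), ∃ a : ℤ, charSum C T = 2 ^ (τ + 1) * a := by
    intro T hT
    have hc := (Finset.mem_powersetCard.1 hT).2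
    have h1 := sum_powerset_charSum C T
    rw [sum_powerset_charSum_of_card_eq_succ C h hc, hM, hc] at h1
    push_cast at h1
    exact ⟨((Finset.univ.filter fun r => ∀ i ∈ T, C r i = 0).card : ℤ) - (2 * l + 1), by
      linear_combination h1⟩
  choose! a ha using hT
  have h1 := sum_powerset_charSum C S
  rw [sum_powerset_charSum_of_card_eq_add_two C h hS, hM, hS, Finset.sum_congr rfl ha,
    ← Finset.mul_sum] at h1
  push_cast at h1
  set k : ℤ := ((Finset.univ.filter fun r => ∀ i ∈ S, C r i = 0).card : ℤ)
  set A := ∑ T ∈ S.powersetCard (τ + 1), a T with hA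
  have h2 : charSum C S = 2 ^ (τ + 1) * (2 * (k - l) - 1 - A) := by
    linear_combination h1
  rw [Finset.sum_congr rfl fun T hT => by rw [ha T hT, mul_pow], ← Finset.mul_sum, h2, mul_pow,
    ← mul_add]
  refine le_mul_of_one_le_right (by positivity) ?_
  -- Otherwise all `a T` vanish, and with them the integer 2(k - l) - 1 - A, which is odd once A =
  -- 0.
  by_contra hlt
  have hn1 := sq_nonneg (2 * (k - l) - 1 - A)
  have hn2 : 0 ≤ ∑ T ∈ S.powersetCard (τ + 1), a T ^ 2 := Finset.sum_nonneg fun T _ => sq_nonneg _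
  have hz : ∑ T ∈ S.powersetCard (τ + 1), a T ^ 2 = 0 := by omega
  have hz1 : (2 * (k - l) - 1 - A) ^ 2 = 0 := by omega
  have hA0 : A = 0 := Finset.sum_eq_zero fun T hT =>
    (pow_eq_zero_iff two_ne_zero).1
      ((Finset.sum_eq_zero_iff_of_nonneg fun T _ => sq_nonneg _).1 hz T hT)
  rw [hA0, pow_eq_zero_iff two_ne_zero] at hz1
  omega

end CharSum

/-- Summing over the `(m + 1)`-sets and then over their `m`-subsets counts every `m`-set `n - m`
times. -/
theorem sum_powersetCard_sum_powersetCard {n : ℕ} (m : ℕ) (g : Finset (Fin n) → ℤ) :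
    ∑ S ∈ Finset.univ.powersetCard (m + 1), ∑ T ∈ S.powersetCard m, g T =
      (n - m : ℕ) * ∑ T ∈ Finset.univ.powersetCard m, g T := by
  rw [Finset.sum_comm' (t' := Finset.univ.powersetCard m)
    (s' := fun T => Tᶜ.image fun i => insert i T), Finset.mul_sum]
  · refine Finset.sum_congr rfl fun T hT => ?_
    rw [Finset.sum_const, Finset.card_image_of_injOn, Finset.card_compl, Fintype.card_fin,
      (Finset.mem_powersetCard.1 hT).2, nsmul_eq_mul]
    intro i hi j hj hij
    have hi' : i ∉ T := by simpa using hi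
    have : i ∈ insert j T := by
      have hij' : insert i T = insert j T := hij
      rw [← hij']; exact Finset.mem_insert_self i T
    exact (Finset.mem_insert.1 this).resolve_right hi'
  · intro S T
    simp only [Finset.mem_powersetCard, Finset.subset_univ, true_and, Finset.mem_image,
      Finset.mem_compl]
    constructor
    · rintro ⟨hS, hTS, hT⟩
      refine ⟨?_, hT⟩
      have hc : (S \ T).card = 1 := by rw [Finset.card_sdiff_of_subset hTS]; omega
      obtain ⟨i, hi⟩ := Finset.card_eq_one.1 hc
      have hi' : i ∈ S \ T := by rw [hi]; exact Finset.mem_singleton_self i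
      refine ⟨i, (Finset.mem_sdiff.1 hi').2, ?_⟩
      rw [Finset.insert_eq, ← hi, Finset.sdiff_union_of_subset hTS]
    · rintro ⟨⟨i, hi, rfl⟩, hT⟩
      exact ⟨by rw [Finset.card_insert_of_notMem hi, hT], Finset.subset_insert i T, hT⟩

/-! ### Numerical contradictions and shortening -/

section Nonexistence

variable {R : Type*} [Fintype R]

theorem sum_powersetCard_le_sum_sq_charSum {n : ℕ} (C : R → Fin n → Fin 2) {a b : ℕ} (hab : a ≠ b)
    (ha : a ≠ 0) (hb : b ≠ 0) :
    (Fintype.card R : ℤ) ^ 2 + (∑ S ∈ Finset.univ.powersetCard a, charSum C S ^ 2 +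
      ∑ S ∈ Finset.univ.powersetCard b, charSum C S ^ 2) ≤ ∑ S, charSum C S ^ 2 := by
  have hd : Disjoint (Finset.univ.powersetCard a : Finset (Finset (Fin n)))
      (Finset.univ.powersetCard b) := Finset.pairwise_disjoint_powersetCard _ hab
  rw [← Finset.sum_union hd, ← charSum_empty C, ← Finset.sum_insert (f := fun S => charSum C S ^ 2)]
  · exact Finset.sum_le_sum_of_subset_of_nonneg (Finset.subset_univ _) fun S _ _ => sq_nonneg _
  · simp [Finset.mem_powersetCard, ha.symm, hb.symm]

theorem card_ne_of_charSumsVanish_twelve_eight_eleven (C : R → Fin 12 → Fin 2)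
    (h : CharSumsVanish C 8) : Fintype.card R ≠ 2816 := by
  intro hM
  have hup := three_mul_sum_sq_charSum_le C h (by norm_num) (by rw [hM]; norm_num)
  have hlow := sum_powersetCard_le_sum_sq_charSum C (a := 9) (b := 10) (by norm_num)
    (by norm_num) (by norm_num)
  have h9 : ∑ _S ∈ (Finset.univ.powersetCard 9 : Finset (Finset (Fin 12))), ((2 : ℤ) ^ 8) ^ 2 ≤
      ∑ S ∈ Finset.univ.powersetCard 9, charSum C S ^ 2 :=
    Finset.sum_le_sum fun S hS => two_pow_sq_le_sq_charSum C h (lam := 11) (by decide)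
      (by rw [hM]; norm_num) (Finset.mem_powersetCard.1 hS).2
  have h10 : 0 ≤ ∑ S ∈ Finset.univ.powersetCard 10, charSum C S ^ 2 :=
    Finset.sum_nonneg fun S _ => sq_nonneg _
  have hch : Nat.choose 12 9 = 220 := by decide
  rw [Finset.sum_const, Finset.card_powersetCard, Finset.card_univ, Fintype.card_fin, hch] at h9
  rw [hM] at hup hlow
  -- Beyond M², the squares total at most 5046272 by `hup`, but at least 220·2^16 = 14417920 by
  -- `h9`.
  norm_num at hup hlow h9
  linarith

theorem card_ne_of_charSumsVanish_twelve_eight_ten (C : R → Fin 12 → Fin 2)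
    (h : CharSumsVanish C 8) : Fintype.card R ≠ 2560 := by
  intro hM
  have hup := three_mul_sum_sq_charSum_le C h (by norm_num) (by rw [hM]; norm_num)
  have hlow := sum_powersetCard_le_sum_sq_charSum C (a := 9) (b := 10) (by norm_num)
    (by norm_num) (by norm_num)
  have h10 : ∑ _S ∈ (Finset.univ.powersetCard 10 : Finset (Finset (Fin 12))), ((2 : ℤ) ^ 9) ^ 2 ≤
      ∑ S ∈ Finset.univ.powersetCard 10,
        (charSum C S ^ 2 + ∑ T ∈ S.powersetCard 9, charSum C T ^ 2) :=
    Finset.sum_le_sum fun S hS => two_pow_succ_sq_le_sum_sq_charSum C h (l := 2)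
      (by rw [hM]; norm_num) (Finset.mem_powersetCard.1 hS).2
  have hch : Nat.choose 12 10 = 66 := by decide
  rw [Finset.sum_const, Finset.card_powersetCard, Finset.card_univ, Fintype.card_fin, hch,
    Finset.sum_add_distrib, sum_powersetCard_sum_powersetCard] at h10
  have hp : 0 ≤ ∑ S ∈ Finset.univ.powersetCard 10, charSum C S ^ 2 :=
    Finset.sum_nonneg fun S _ => sq_nonneg _
  rw [hM] at hup hlow
  -- Each 9-set lies in three 10-sets, so `h10` and `hp` give 66·2^18 ≤ 3(Σ₉ + Σ₁₀), where Σ_j sums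
  -- the squares over j-sets. Thus Σ₉ + Σ₁₀ ≥ 5767168, while `hup` and `hlow` allow less than
  -- 4805974.
  norm_num at hup hlow h10
  linarith

/-- The rows of an array which start with `0`, with their first entry deleted. -/
def shortenedArray {n : ℕ} (C : R → Fin (n + 1) → Fin 2) (r : {r : R // C r 0 = 0}) :
    Fin n → Fin 2 :=
  fun i => C r i.succ

/-- Adding column 0 to the set multiplies the character by ±1 according to the first entry, so rows
starting with 1 cancel. -/
theorem two_mul_charSum_shortenedArray {n : ℕ} (C : R → Fin (n + 1) → Fin 2)
    (S : Finset (Fin n)) :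
    2 * charSum (shortenedArray C) S =
      charSum C (S.map (Fin.succEmb n)) + charSum C (insert 0 (S.map (Fin.succEmb n))) := by
  have h0 : (0 : Fin (n + 1)) ∉ S.map (Fin.succEmb n) := by
    simp [Fin.succ_ne_zero]
  have hr : ∀ r, cubeChar (S.map (Fin.succEmb n)) (C r) +
      cubeChar (insert 0 (S.map (Fin.succEmb n))) (C r) =
      if C r 0 = 0 then 2 * cubeChar S (fun i => C r i.succ) else 0 := by
    intro r
    have hmap : cubeChar (S.map (Fin.succEmb n)) (C r) = cubeChar S (fun i => C r i.succ) := by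
      simp [cubeChar]
    have hins : cubeChar (insert 0 (S.map (Fin.succEmb n))) (C r) =
        (-1) ^ (C r 0 : ℕ) * cubeChar (S.map (Fin.succEmb n)) (C r) := by
      simp only [cubeChar]
      rw [Finset.prod_insert h0]
    rw [hins, hmap]
    split_ifs with h
    · rw [h]; simp; ring
    · have h1 : C r 0 = 1 := by omega
      rw [h1]; simp
  unfold charSum
  rw [← Finset.sum_add_distrib]
  simp only [hr]
  rw [← Finset.sum_filter, Finset.mul_sum]
  exact (Finset.sum_subtype (p := fun r => C r 0 = 0) _ (by simp)
    (fun r => 2 * cubeChar S (fun i => C r i.succ))).symm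

theorem CharSumsVanish.shortenedArray {n τ : ℕ} {C : R → Fin (n + 1) → Fin 2}
    (h : CharSumsVanish C (τ + 1)) : CharSumsVanish (shortenedArray C) τ := by
  intro S hS hc
  have h2 := two_mul_charSum_shortenedArray C S
  rw [h _ (hS.map) (by rw [Finset.card_map]; omega), h _ (Finset.insert_nonempty _ _)
    ((Finset.card_insert_le _ _).trans (by rw [Finset.card_map]; omega))] at h2
  omega

theorem two_mul_card_shortenedArray {n τ : ℕ} {C : R → Fin (n + 1) → Fin 2}
    (h : CharSumsVanish C (τ + 1)) : 2 * Fintype.card {r : R // C r 0 = 0} = Fintype.card R := by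
  have h2 := two_mul_charSum_shortenedArray C ∅
  rw [Finset.map_empty, charSum_empty, charSum_empty, h _ (Finset.insert_nonempty _ _)
    (by simp)] at h2
  omega

end Nonexistence

/-! ### From orthogonal arrays to character sums -/

theorem IsBinaryOrthogonalArray.charSumsVanish {M n τ lam : ℕ} {C : Matrix (Fin M) (Fin n) (Fin 2)}
    (h : IsBinaryOrthogonalArray C τ lam) : CharSumsVanish (R := Fin M) C τ := by
  intro S hS hc
  obtain ⟨hτ, -, hcol⟩ := h
  -- Enlarging S to exactly τ columns makes the multiplicities constant, and a nontrivial character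
  -- sums to zero over the cube.
  obtain ⟨U, hSU, -, hU⟩ := Finset.exists_subsuperset_card_eq (Finset.subset_univ S) hc
    (by simpa using hτ)
  let e : Fin τ ↪o Fin n := U.orderEmbOfFin hU
  let S' : Finset (Fin τ) := Finset.univ.filter fun j => e j ∈ S
  have hS' : S'.map e.toEmbedding = S := by
    ext i
    simp only [S', Finset.mem_map, Finset.mem_filter, Finset.mem_univ, true_and]
    constructor
    · rintro ⟨j, hj, rfl⟩
      exact hj
    · intro hi
      have : i ∈ Set.range e := by
        rw [Finset.range_orderEmbOfFin]
        exact hSU hi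
      obtain ⟨j, rfl⟩ := this
      exact ⟨j, hi, rfl⟩
  have hne : S'.Nonempty := by
    rw [← Finset.map_nonempty (f := e.toEmbedding), hS']
    exact hS
  have hchar : ∀ r, cubeChar S (C r) = cubeChar S' (fun j => C r (e j)) := by
    intro r
    rw [← hS']
    simp [cubeChar]
  have hmult : ∀ t, rowMult (fun r j => C r (e j)) t = lam := by
    intro t
    rw [rowMult, ← hcol e t]
    simp only [funext_iff]
  unfold charSum
  simp only [hchar]
  rw [← sum_rowMult_mul (fun r j => C r (e j)) (cubeChar S')]
  simp only [hmult]
  rw [← Finset.mul_sum, sum_cubeChar_of_nonempty hne, mul_zero]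

theorem ExistsBOA.exists_charSumsVanish {n M τ : ℕ} (h : ExistsBOA n M τ) :
    ∃ C : Fin M → Fin n → Fin 2, CharSumsVanish C τ := by
  obtain ⟨C, lam, hC⟩ := h
  exact ⟨C, hC.charSumsVanish⟩

/-- A shortened array: half the rows, one column fewer and strength one less. -/
theorem ExistsBOA.exists_charSumsVanish_of_succ {n M τ : ℕ} (h : ExistsBOA (n + 1) M (τ + 1)) :
    ∃ (R : Type) (_ : Fintype R) (C : R → Fin n → Fin 2),
      CharSumsVanish C τ ∧ 2 * Fintype.card R = M := by
  obtain ⟨C, hC⟩ := h.exists_charSumsVanish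
  exact ⟨_, inferInstance, shortenedArray C, hC.shortenedArray, by
    rw [two_mul_card_shortenedArray hC, Fintype.card_fin]⟩

theorem theorem6p1p1 :
    ¬ ExistsBOA 10 448 6 ∧
    ¬ ExistsBOA 11 896 7 ∧
    ¬ ExistsBOA 12 2560 8 ∧
    ¬ ExistsBOA 13 5120 9 ∧
    ¬ ExistsBOA 12 2816 8 ∧
    ¬ ExistsBOA 13 5632 9 ∧
    ¬ ExistsBOA 15 13312 10 := by
  refine ⟨fun h => ?_, fun h => ?_, fun h => ?_, fun h => ?_, fun h => ?_, fun h => ?_,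
    fun h => ?_⟩
  · obtain ⟨C, hC⟩ := h.exists_charSumsVanish
    have := two_pow_le_two_mul_card C hC (by norm_num)
    rw [Fintype.card_fin] at this
    norm_num at this
  · obtain ⟨R, _, C, hC, hM⟩ := h.exists_charSumsVanish_of_succ
    have : Nonempty R := Fintype.card_pos_iff.1 (by omega)
    have := two_pow_le_two_mul_card C hC (by norm_num)
    rw [hM] at this
    norm_num at this
  · obtain ⟨C, hC⟩ := h.exists_charSumsVanish
    exact card_ne_of_charSumsVanish_twelve_eight_ten C hC (Fintype.card_fin _)
  · obtain ⟨R, _, C, hC, hM⟩ := h.exists_charSumsVanish_of_succ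
    exact card_ne_of_charSumsVanish_twelve_eight_ten C hC (by omega)
  · obtain ⟨C, hC⟩ := h.exists_charSumsVanish
    exact card_ne_of_charSumsVanish_twelve_eight_eleven C hC (Fintype.card_fin _)
  · obtain ⟨R, _, C, hC, hM⟩ := h.exists_charSumsVanish_of_succ
    exact card_ne_of_charSumsVanish_twelve_eight_eleven C hC (by omega)
  · obtain ⟨C, hC⟩ := h.exists_charSumsVanish
    have := two_pow_le_two_mul_card C hC (by norm_num)
    rw [Fintype.card_fin] at this
    norm_num at this
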